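/- \textbf{Theorem.} For a finite simple graph $G=(V,E)$ consider the greedy algorithm: start with $V'=\emptyset$ and $F=V$; while $F\neq\emptyset$, choose a vertex $v\in F$, search for the set $N_F(v)$ of all neighbours of $v$ in $F$, put $W=N_F(v)\cup\{v\}$, add $v$ to $V'$ and replace $F$ by $F\setminus W$. The choice of $v$ is made by an arbitrary fixed rule $c$, a function of the current pair $(V',F)$. The \emph{run} of the algorithm on $G$ is the list of the pairs $(v,W)$ of all iterations. A \emph{quantum query algorithm} with $T$ queries to a string $x\in A^I$ ($I$ a finite index set, $A$ a finite abelian group) acts on the span of the basis states $|i,a,w\rangle$, $i\in I\cup\{\bot\}$, $a\in A$, $w$ in a finite set. It starts in a fixed basis state, applies $U_T O_x U_{T-1}\cdots O_x U_0$, where the unitaries $U_t$ do not depend on $x$ and $O_x|i,a,w\rangle=|i,a+x_i,w\rangle$ for $i\in I$, $O_x|\bot,a,w\rangle=|\bot,a,w\rangle$, measures in the computational basis, and outputs a function of the measured basis state. Let $V=[n]$ and $m=|E|$. 1. For every $G$ and every choice rule $c$, the set $V'$ that the greedy algorithm returns is a maximal independent set of $G$. 2. (Adjacency matrix model.) There is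 an absolute constant $C$ such that for every $n\ge1$ and every choice rule $c$ there is a quantum query algorithm that makes at most $C\,n^{3/2}$ queries to the adjacency matrix and, for every graph $G$ on $[n]$, outputs the run of the greedy algorithm with rule $c$ on $G$ (hence the maximal independent set $V'$) with probability at least $2/3$. 3. (Adjacency list model: the degrees $d_1,\dots,d_n$ are given, and each query returns a value $f_i(j)$, the $j$-th neighbour of vertex $i$, $1\le j\le d_i$, where the arrays $f_i$ list the neighbours in an arbitrary order.) There is an absolute constant $C$ such that for every $n\ge 1$, all degrees $d_1,\dots,d_n$ and every choice rule $c$ there is a quantum query algorithm that, for every graph $G$ on $[n]$ with these degrees and every adjacency list of $G$, makes at most $C\sqrt{nm}$ queries and outputs the run of the greedy algorithm with rule $c$ on $G$ with probability at least $2/3$. -/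

import Mathlib

/-! ### Quantum query algorithms

An input is a string `x : I → A` over a finite alphabet `A` (a finite additive group), with finite
index set `I`.  A computational basis state consists of a query register (an index, or `none` for
the null query), an answer register, and a workspace register. -/

/-- Computational basis states with workspace `W`. -/
abbrev QBasis (I A W : Type) : Type := Option I × A × W

/-- The query unitary `|i, a, w⟩ ↦ |i, a + x i, w⟩`, `|none, a, w⟩ ↦ |none, a, w⟩`,
acting on state vectors. -/
def applyOracle {I A W : Type} [AddCommGroup A] (x : I → A) (ψ : QBasis I A W → ℂ) :
    QBasis I A W → ℂ
  | (some i, a, w) => ψ (some i, a - x i, w)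
  | (none, a, w) => ψ (none, a, w)

/-- A quantum query algorithm with outputs in `α`: it starts in the basis state `init`, applies
`U 0`, then alternates `queries` many queries with the input-independent unitaries
`U 1, …, U queries`, measures in the computational basis and outputs `out b` on the
measurement result `b`. -/
structure QueryAlgorithm (I A α : Type) [Fintype I] [DecidableEq I] [Fintype A] [DecidableEq A] where
  /-- basis of the workspace register -/
  W : Type
  [fintypeW : Fintype W]
  [decEqW : DecidableEq W]
  /-- number of queries -/
  queries : ℕ
  /-- the unitaries (only `U 0, …, U queries` are used) -/
  U : ℕ → Matrix.unitaryGroup (QBasis I A W) ℂ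
  init : QBasis I A W
  out : QBasis I A W → α

attribute [instance] QueryAlgorithm.fintypeW QueryAlgorithm.decEqW

namespace QueryAlgorithm

variable {I A α : Type} [Fintype I] [DecidableEq I] [Fintype A] [DecidableEq A] [AddCommGroup A]

/-- The state after `t` queries (and the unitary that follows the last of them) on input `x`. -/
noncomputable def state (𝒜 : QueryAlgorithm I A α) (x : I → A) : ℕ → QBasis I A 𝒜.W → ℂ
  | 0 => (𝒜.U 0).1.mulVec (Pi.single 𝒜.init 1)
  | t + 1 => (𝒜.U (t + 1)).1.mulVec (applyOracle x (𝒜.state x t))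

open Classical in
/-- The probability that the algorithm outputs `a` on input `x`. -/
noncomputable def prob (𝒜 : QueryAlgorithm I A α) (x : I → A) (a : α) : ℝ :=
  ∑ b : QBasis I A 𝒜.W, if 𝒜.out b = a then ‖𝒜.state x 𝒜.queries b‖ ^ 2 else 0

end QueryAlgorithm

/-! ### The two input models for graphs on the vertex set `Fin n` -/

open Classical in
/-- The adjacency matrix of `G`, as an input string. -/
noncomputable def adjMatrixInput {n : ℕ} (G : SimpleGraph (Fin n)) : Fin n × Fin n → Fin 2 :=
  fun p => if G.Adj p.1 p.2 then 1 else 0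

/-- `f` is an adjacency list of `G`, with degrees `d`: for every vertex `i`, the array
`f ⟨i, 0⟩, …, f ⟨i, d i - 1⟩` lists the neighbours of `i`, each of them once, in some order. -/
def IsAdjList {n : ℕ} (G : SimpleGraph (Fin n)) (d : Fin n → ℕ)
    (f : (Σ i : Fin n, Fin (d i)) → Fin n) : Prop :=
  ∀ i : Fin n, Function.Injective (fun j : Fin (d i) => f ⟨i, j⟩) ∧
    Set.range (fun j : Fin (d i) => f ⟨i, j⟩) = G.neighborSet i

/-! ### The greedy algorithm -/

/-- A rule for the step "choose `v ∈ V(F)`": it picks a vertex of the nonempty set `F` of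
remaining vertices, depending on `F` and on the set `S` of vertices chosen so far. -/
structure ChoiceRule (V : Type) where
  pick : (S F : Finset V) → F.Nonempty → V
  pick_mem : ∀ S F h, pick S F h ∈ F

open Classical in
/-- The loop of the greedy algorithm, started with the chosen vertices `S` and the remaining
vertices `F`: while `F` is nonempty, choose `v ∈ F`, let `W` consist of `v` and all its neighbours
in `F`, put `v` into `S` and delete `W` from `F`.  The result is the list of the pairs `(v, W)`
in the order of the iterations. -/
noncomputable def greedyLoop {V : Type} (G : SimpleGraph V) (c : ChoiceRule V)
    (S F : Finset V) : List (V × Finset V) :=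
  if h : F.Nonempty then
    (c.pick S F h, insert (c.pick S F h) (F.filter (G.Adj (c.pick S F h)))) ::
      greedyLoop G c (insert (c.pick S F h) S)
        (F \ insert (c.pick S F h) (F.filter (G.Adj (c.pick S F h))))
  else []
termination_by F.card
decreasing_by
  exact Finset.card_lt_card ((Finset.ssubset_iff_of_subset Finset.sdiff_subset).2
    ⟨c.pick S F h, c.pick_mem S F h, fun hm =>
      (Finset.mem_sdiff.1 hm).2 (Finset.mem_insert_self _ _)⟩)

/-- The complete run of the greedy algorithm on `G`. -/
noncomputable def greedyRun {V : Type} [Fintype V] (G : SimpleGraph V) (c : ChoiceRule V) :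
    List (V × Finset V) :=
  greedyLoop G c ∅ Finset.univ

/-- The set `V'` returned by a run: all chosen vertices. -/
def chosenVertices {V : Type} (r : List (V × Finset V)) : Set V :=
  {v | v ∈ r.map Prod.fst}

/-! ### Maximality of the greedy set -/

/-! Maximality holds because each iteration deletes exactly the chosen vertex and its remaining
neighbours. The query bounds come from a classical decision tree computing the whole run, whose
answers are guessed in advance. At a node the expected answer gets weight `√a`, a surprise `(√a)⁻¹`,
so different answers have weight product 1. Two inputs with different transcripts part at exactly
one node, so the weights solve the dual adversary problem; the cost is the largest sum of squared
weights along a path (`HasQueryScheme.node`).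

`HasQueryScheme.exists_queryAlgorithm` turns cost `K` into `⌈72 * K⌉₊` queries: explicit vectors
moving from a start symbol to the transcript have Gram matrices compatible with the query, so
input-independent unitaries follow them exactly, and only the initial state is off.

The guess is that a queried entry reveals no new neighbour in `F`. Every wrong guess deletes a
vertex, so there are at most `n` of them on a path. With at most `n ^ 2` queries (matrix) or `2 * m`
(list), balancing `a` gives `O(n ^ (3/2))` and `O(√(n * m))`. -/

theorem greedyLoop_empty {V : Type} (G : SimpleGraph V) (c : ChoiceRule V) (S : Finset V) :
    greedyLoop G c S ∅ = [] := by
  rw [greedyLoop]; simp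

/-- Describing `N` by membership lets it be a set assembled from query answers, the same for all
graphs in a branch of the tree. -/
theorem greedyLoop_of_nonempty {V : Type} [DecidableEq V] (G : SimpleGraph V) (c : ChoiceRule V)
    (S F : Finset V) (h : F.Nonempty) (N : Finset V)
    (hN : ∀ w, w ∈ N ↔ w ∈ F ∧ G.Adj (c.pick S F h) w) :
    greedyLoop G c S F = (c.pick S F h, insert (c.pick S F h) N) ::
      greedyLoop G c (insert (c.pick S F h) S) (F \ insert (c.pick S F h) N) := by
  classical
  obtain rfl : N = F.filter (G.Adj (c.pick S F h)) := by
    ext w; rw [hN, Finset.mem_filter]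
  rw [greedyLoop, dif_pos h]
  congr!

open Classical in
theorem chosenVertices_greedyLoop {V : Type} (G : SimpleGraph V) (c : ChoiceRule V)
    (S F : Finset V) :
    chosenVertices (greedyLoop G c S F) ⊆ F ∧
      G.IsIndepSet (chosenVertices (greedyLoop G c S F)) ∧
      ∀ u ∈ F, u ∉ chosenVertices (greedyLoop G c S F) →
        ∃ w ∈ chosenVertices (greedyLoop G c S F), G.Adj w u := by
  induction hk : F.card using Nat.strong_induction_on generalizing S F with
  | _ k ih =>
    rcases F.eq_empty_or_nonempty with rfl | h
    · simp [greedyLoop_empty, chosenVertices, SimpleGraph.IsIndepSet]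
    · rw [greedyLoop_of_nonempty G c S F h _ fun w => Finset.mem_filter]
      set v := c.pick S F h with hv
      have hvF : v ∈ F := c.pick_mem S F h
      set F' := F \ insert v (F.filter (G.Adj v)) with hF'
      have hlt : F'.card < k := hk ▸ Finset.card_lt_card
        ((Finset.ssubset_iff_of_subset Finset.sdiff_subset).2 ⟨v, hvF, by simp⟩)
      obtain ⟨h1, h2, h3⟩ := ih _ hlt (insert v S) F' rfl
      have key : ∀ L, chosenVertices ((v, insert v (F.filter (G.Adj v))) :: L) =
          insert v (chosenVertices L) := by
        intro L; ext u; simp [chosenVertices]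
      rw [key]
      refine ⟨?_, ?_, ?_⟩
      · intro u hu
        rcases hu with rfl | hu
        · exact hvF
        · exact Finset.sdiff_subset (h1 hu)
      · rw [SimpleGraph.isIndepSet_iff]
        -- Later choices lie in `F'`, which contains no neighbour of `v`.
        refine Set.Pairwise.insert h2 fun u hu _ => ?_
        have := h1 hu
        simp only [hF', Finset.coe_sdiff, Set.mem_sdiff, Finset.mem_coe, Finset.mem_insert,
          Finset.mem_filter, not_or, not_and] at this
        exact ⟨this.2.2 this.1, fun h => this.2.2 this.1 h.symm⟩
      · intro u hu hun
        by_cases huv : G.Adj v u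
        · exact ⟨v, Set.mem_insert _ _, huv⟩
        · have hne : u ≠ v := fun e => hun (e ▸ Set.mem_insert _ _)
          obtain ⟨w, hw, hwu⟩ := h3 u (by simp [hF', hu, hne, huv])
            (fun h => hun (Set.mem_insert_of_mem _ h))
          exact ⟨w, Set.mem_insert_of_mem _ hw, hwu⟩

theorem maximal_chosenVertices_greedyRun {V : Type} [Fintype V] (G : SimpleGraph V)
    (c : ChoiceRule V) :
    Maximal (fun S : Set V => G.IsIndepSet S) (chosenVertices (greedyRun G c)) := by
  obtain ⟨-, h2, h3⟩ := chosenVertices_greedyLoop G c ∅ Finset.univ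
  refine ⟨h2, fun T hT hle u hu => ?_⟩
  by_contra hun
  obtain ⟨w, hw, hwu⟩ := h3 u (Finset.mem_univ u) hun
  exact hT (hle hw) hu hwu.ne hwu

/-! ### Unitaries from equal Gram matrices -/

/-- Equal Gram matrices give corresponding linear combinations equal norms, so `p x ↦ q x` is a
well-defined isometry on the span; in finite dimension it extends to a unitary. -/
theorem exists_unitary_of_gram_eq {ι X : Type} [Fintype ι] [DecidableEq ι] (p q : X → ι → ℂ)
    (h : ∀ x y, star (p x) ⬝ᵥ p y = star (q x) ⬝ᵥ q y) :
    ∃ U : Matrix.unitaryGroup ι ℂ, ∀ x, U.1.mulVec (p x) = q x := by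
  let P : (X →₀ ℂ) →ₗ[ℂ] EuclideanSpace ℂ ι := Finsupp.linearCombination ℂ fun x => WithLp.toLp 2 (p x)
  let Q : (X →₀ ℂ) →ₗ[ℂ] EuclideanSpace ℂ ι := Finsupp.linearCombination ℂ fun x => WithLp.toLp 2 (q x)
  have hin : ∀ a b, inner ℂ (P a) (P b) = inner ℂ (Q a) (Q b) := by
    intro a b
    simp only [P, Q, Finsupp.linearCombination_apply, Finsupp.sum, sum_inner, inner_sum,
      inner_smul_left, inner_smul_right]
    refine Finset.sum_congr rfl fun x _ => ?_
    congr 1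
    refine Finset.sum_congr rfl fun y _ => ?_
    rw [EuclideanSpace.inner_toLp_toLp, EuclideanSpace.inner_toLp_toLp, dotProduct_comm,
      dotProduct_comm (q _), h]
  have hnorm : ∀ a, ‖Q a‖ = ‖P a‖ := fun a => by
    rw [@norm_eq_sqrt_re_inner ℂ, @norm_eq_sqrt_re_inner ℂ _ _ _ _ (P a), hin]
  have hker : LinearMap.ker P ≤ LinearMap.ker Q := fun a ha => by
    rw [LinearMap.mem_ker] at ha ⊢
    rw [← norm_eq_zero, hnorm, ha, norm_zero]
  let L₀ : LinearMap.range P →ₗ[ℂ] EuclideanSpace ℂ ι :=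
    (LinearMap.ker P).liftQ Q hker ∘ₗ (P.quotKerEquivRange.symm : _ →ₗ[ℂ] _)
  have hL₀ : ∀ a, L₀ ⟨P a, a, rfl⟩ = Q a := fun a => by
    have : P.quotKerEquivRange.symm ⟨P a, a, rfl⟩ = (LinearMap.ker P).mkQ a := by
      rw [LinearEquiv.symm_apply_eq]; rfl
    simp [L₀, this]
  let L : LinearMap.range P →ₗᵢ[ℂ] EuclideanSpace ℂ ι := ⟨L₀, by
    rintro ⟨_, a, rfl⟩
    rw [hL₀, hnorm]; rfl⟩
  let M : EuclideanSpace ℂ ι →ₗᵢ[ℂ] EuclideanSpace ℂ ι := L.extend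
  have hM : ∀ x, M (WithLp.toLp 2 (p x)) = WithLp.toLp 2 (q x) := fun x => by
    have h1 : P (Finsupp.single x 1) = WithLp.toLp 2 (p x) := by simp [P]
    have h2 : Q (Finsupp.single x 1) = WithLp.toLp 2 (q x) := by simp [Q]
    rw [← h1, ← h2, ← hL₀]
    exact L.extend_apply ⟨P (Finsupp.single x 1), _, rfl⟩
  let A : Matrix ι ι ℂ := Matrix.of fun i j => M (WithLp.toLp 2 (Pi.single j 1)) i
  have hA : ∀ u : ι → ℂ, A.mulVec u = WithLp.ofLp (M (WithLp.toLp 2 u)) := by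
    intro u
    have hu : (WithLp.toLp 2 u : EuclideanSpace ℂ ι) = ∑ j, u j • WithLp.toLp 2 (Pi.single j 1) := by
      ext i; simp [Finset.sum_apply, Pi.single_apply]
    rw [hu, map_sum]
    ext i
    simp only [A, Matrix.mulVec, dotProduct, map_smul, WithLp.ofLp_sum, Finset.sum_apply,
      Matrix.of_apply, WithLp.ofLp_smul, Pi.smul_apply, smul_eq_mul, mul_comm]
  refine ⟨⟨A, ?_⟩, fun x => by rw [hA, hM]⟩
  rw [Matrix.mem_unitaryGroup_iff']
  ext i j
  have := M.inner_map_map (WithLp.toLp 2 (Pi.single i 1)) (WithLp.toLp 2 (Pi.single j 1))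
  rw [EuclideanSpace.inner_toLp_toLp, EuclideanSpace.inner_toLp_toLp, dotProduct_comm] at this
  refine this.trans ?_
  simp [Matrix.one_apply, Pi.single_apply]

/-! ### Weighted query trees -/

/-- A weighted query scheme of cost `K` for the function `out` of the inputs `inp x`, `x ∈ P`.
The elements of `E` are the nodes of a decision tree: at the node `e` the coarse information
`g e (inp x (idx e))` is asked for, `r e x` is the weight with which `x` passes through `e` (zero
if it does not), and `τ x` is the transcript of the answers. -/
def HasQueryScheme {I A X α : Type} (B : Type) [DecidableEq B] (inp : X → I → A) (P : Set X)
    (out : X → α) (K : ℝ) : Prop :=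
  ∃ (E : Type) (_ : Fintype E) (idx : E → I) (g : E → A → B) (r : E → X → ℝ) (τ : X → List B),
    (∀ x ∈ P, ∀ y ∈ P, τ x = τ y → out x = out y) ∧
    (∀ x ∈ P, ∀ y ∈ P,
      ∑ e, (if g e (inp x (idx e)) = g e (inp y (idx e)) then 0 else r e x * r e y) =
        if τ x = τ y then 0 else 1) ∧
    ∀ x ∈ P, ∑ e, r e x ^ 2 ≤ K

namespace HasQueryScheme

variable {I A X α β B : Type} [DecidableEq B] {inp : X → I → A} {P P' : Set X} {out : X → α}
  {K K' : ℝ}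

theorem of_const (h : ∀ x ∈ P, ∀ y ∈ P, out x = out y) (hK : 0 ≤ K) :
    HasQueryScheme B inp P out K :=
  ⟨Empty, inferInstance, Empty.elim, fun e => e.elim, fun e => e.elim, fun _ => [],
    fun x hx y hy _ => h x hx y hy, by simp, by simpa using fun _ _ => hK⟩

/-- `K` may be negative: this disposes of branches that no input reaches and whose cost nothing pays
for. -/
theorem of_empty (h : ∀ x, x ∉ P) : HasQueryScheme B inp P out K :=
  ⟨Empty, inferInstance, Empty.elim, fun e => e.elim, fun e => e.elim, fun _ => [],
    fun x hx => (h x hx).elim, fun x hx => (h x hx).elim, fun x hx => (h x hx).elim⟩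

theorem mono (h : HasQueryScheme B inp P out K) (hP : P' ⊆ P) (hK : K ≤ K') {out' : X → β}
    (hout : ∀ x ∈ P', ∀ y ∈ P', out x = out y → out' x = out' y) :
    HasQueryScheme B inp P' out' K' := by
  obtain ⟨E, _, idx, g, r, τ, h1, h2, h3⟩ := h
  exact ⟨E, _, idx, g, r, τ,
    fun x hx y hy e => hout x hx y hy (h1 x (hP hx) y (hP hy) e),
    fun x hx y hy => h2 x (hP hx) y (hP hy), fun x hx => (h3 x (hP hx)).trans hK⟩

/-- Query the coarse information `g` about the entry `i`, with weight `r b` on the answer `b`. -/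
theorem node [Fintype B] (i : I) (g : A → B) (r : B → ℝ)
    (hr : ∀ z z', g z ≠ g z' → r (g z) * r (g z') = 1)
    (h : ∀ b, HasQueryScheme B inp {x ∈ P | g (inp x i) = b} out (K - r b ^ 2)) :
    HasQueryScheme B inp P out K := by
  choose E hE idx' g' r' τ' h1 h2 h3 using h
  refine ⟨Option (Σ b, E b), inferInstance, fun e => e.elim i fun e => idx' e.1 e.2,
    fun e => e.elim g fun e => g' e.1 e.2,
    fun e x => e.elim (r (g (inp x i))) fun e => if g (inp x i) = e.1 then r' e.1 e.2 x else 0,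
    fun x => g (inp x i) :: τ' (g (inp x i)) x, ?_, ?_, ?_⟩
  · intro x hx y hy hxy
    rw [List.cons.injEq] at hxy
    obtain ⟨hb, ht⟩ := hxy
    rw [hb] at ht
    exact h1 _ x ⟨hx, hb⟩ y ⟨hy, rfl⟩ ht
  · intro x hx y hy
    rw [Fintype.sum_option, Fintype.sum_sigma]
    change (if g (inp x i) = g (inp y i) then 0 else r (g (inp x i)) * r (g (inp y i))) +
      ∑ b, ∑ e, (if g' b e (inp x (idx' b e)) = g' b e (inp y (idx' b e)) then 0 else
        (if g (inp x i) = b then r' b e x else 0) * (if g (inp y i) = b then r' b e y else 0)) = _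
    -- With equal answers only the common subtree contributes; with different answers no subtree is
    -- shared, and the root alone contributes 1.
    by_cases hb : g (inp x i) = g (inp y i)
    · have h0 := h2 _ x ⟨hx, hb⟩ y ⟨hy, rfl⟩
      rw [if_pos hb, zero_add, Finset.sum_eq_single (g (inp y i))]
      · simp only [hb, if_true, List.cons.injEq, true_and]
        exact h0
      · intro b _ hne
        refine Finset.sum_eq_zero fun e _ => ?_
        simp [hb, hne.symm]
      · simp
    · rw [if_neg hb, hr _ _ hb, if_neg (by simp [hb]), add_eq_left]
      refine Finset.sum_eq_zero fun b _ => Finset.sum_eq_zero fun e _ => ?_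
      by_cases hx : g (inp x i) = b
      · have : g (inp y i) ≠ b := fun h => hb (hx.trans h.symm)
        simp [this]
      · simp [hx]
  · intro x hx
    have h0 := h3 _ x ⟨hx, rfl⟩
    rw [Fintype.sum_option, Fintype.sum_sigma, Finset.sum_eq_single (g (inp x i))]
    · simp only [Option.elim, if_true]
      linarith
    · intro b _ hne
      exact Finset.sum_eq_zero fun e _ => by simp [hne.symm]
    · simp

end HasQueryScheme

/-! ### Vectors with one basis state for each workspace state -/

/-- The vector `∑ w, c w • |p w, w⟩`. -/
def sparseVec {I A W : Type} [DecidableEq I] [DecidableEq A] (p : W → Option I × A) (c : W → ℂ) :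
    QBasis I A W → ℂ :=
  fun b => if p b.2.2 = (b.1, b.2.1) then c b.2.2 else 0

section sparse

variable {I A W : Type} [DecidableEq I] [DecidableEq A]

theorem sum_sparse [Fintype I] [Fintype A] [Fintype W] {M : Type} [AddCommMonoid M]
    (p : W → Option I × A) (f : W → M) :
    ∑ b : QBasis I A W, (if p b.2.2 = (b.1, b.2.1) then f b.2.2 else 0) = ∑ w, f w := by
  have e := Fintype.sum_equiv (Equiv.prodAssoc (Option I) A W).symm
    (fun b : QBasis I A W => if p b.2.2 = (b.1, b.2.1) then f b.2.2 else 0)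
    (fun b => if p b.2 = b.1 then f b.2 else 0) (fun _ => rfl)
  rw [e, Fintype.sum_prod_type_right]
  simp

/-- Each workspace state carries one basis state, so overlap at `w` requires equal positions. -/
theorem star_sparseVec_dotProduct [Fintype I] [Fintype A] [Fintype W]
    (p p' : W → Option I × A) (c c' : W → ℂ) :
    star (sparseVec p c) ⬝ᵥ sparseVec p' c' =
      ∑ w, if p w = p' w then star (c w) * c' w else 0 := by
  rw [← sum_sparse p]
  refine Finset.sum_congr rfl fun b _ => ?_
  simp only [sparseVec, Pi.star_apply]
  by_cases h : p b.2.2 = (b.1, b.2.1)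
  · rw [← h]
    simp only [if_true, eq_comm (a := p' b.2.2)]
    split_ifs <;> simp
  · simp [h]

theorem sum_norm_sparseVec_sq [Fintype I] [Fintype A] [Fintype W]
    (p : W → Option I × A) (c : W → ℂ) :
    ∑ b, ‖sparseVec p c b‖ ^ 2 = ∑ w, ‖c w‖ ^ 2 := by
  rw [← sum_sparse p]
  refine Finset.sum_congr rfl fun b _ => ?_
  simp only [sparseVec]
  split_ifs <;> simp

variable [AddCommGroup A]

/-- The action of the query on the query and answer registers. -/
def queryMap (x : I → A) : Option I × A → Option I × A
  | (some i, a) => (some i, a + x i)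
  | (none, a) => (none, a)

theorem applyOracle_sparseVec (x : I → A) (p : W → Option I × A) (c : W → ℂ) :
    applyOracle x (sparseVec p c) = sparseVec (fun w => queryMap x (p w)) c := by
  funext ⟨i, a, w⟩
  rcases h : p w with ⟨j, a'⟩
  rcases i with _ | i <;> rcases j with _ | j <;>
    simp only [applyOracle, sparseVec, queryMap, h, Prod.mk.injEq, reduceCtorEq, false_and,
      Option.some.injEq]
  by_cases hij : j = i
  · subst hij; simp [eq_sub_iff_add_eq]
  · simp [hij]

end sparse

/-! ### Norms along a run of a query algorithm -/

section norms

variable {I A W : Type} [AddCommGroup A]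

theorem applyOracle_sub (x : I → A) (u v : QBasis I A W → ℂ) :
    applyOracle x (u - v) = applyOracle x u - applyOracle x v := by
  funext ⟨i, a, w⟩
  rcases i with _ | i <;> rfl

theorem sum_norm_applyOracle_sq [Fintype I] [Fintype A] [Fintype W] (x : I → A) (u : QBasis I A W → ℂ) :
    ∑ b, ‖applyOracle x u b‖ ^ 2 = ∑ b, ‖u b‖ ^ 2 := by
  simp only [Fintype.sum_prod_type, Fintype.sum_option, applyOracle]
  congr 1
  refine Finset.sum_congr rfl fun i _ => ?_
  exact (Equiv.subRight (x i)).sum_comp fun a => ∑ w, ‖u (some i, a, w)‖ ^ 2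

theorem ofReal_sum_norm_sq {ι : Type} [Fintype ι] (u : ι → ℂ) :
    ((∑ b, ‖u b‖ ^ 2 : ℝ) : ℂ) = star u ⬝ᵥ u := by
  simp [dotProduct, Complex.conj_mul']

theorem sum_norm_unitary_mulVec_sq {ι : Type} [Fintype ι] [DecidableEq ι]
    (U : Matrix.unitaryGroup ι ℂ) (u : ι → ℂ) :
    ∑ b, ‖U.1.mulVec u b‖ ^ 2 = ∑ b, ‖u b‖ ^ 2 := by
  have h : star U.1 * U.1 = 1 := Matrix.mem_unitaryGroup_iff'.1 U.2
  rw [← Complex.ofReal_inj, ofReal_sum_norm_sq, ofReal_sum_norm_sq, Matrix.star_mulVec,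
    ← Matrix.dotProduct_mulVec, Matrix.mulVec_mulVec, ← Matrix.star_eq_conjTranspose, h,
    Matrix.one_mulVec]

end norms

/-! ### From weighted query schemes to quantum query algorithms -/

section schemeVec

variable {I A L E B : Type}

/-- The query and answer registers that go with a workspace state, on input `x`. -/
def schemePos [AddCommGroup A] (idx : E → I) (x : I → A) :
    Option L ⊕ E × Option B → Option I × A
  | .inl _ => (none, 0)
  | .inr (e, none) => (some (idx e), 0)
  | .inr (e, some _) => (some (idx e), -x (idx e))

/-- The amplitudes `p` on the start symbol, `q` on the output `l`, and `s` times the weights on the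
nodes of the query scheme. -/
def schemeCoeff [DecidableEq L] [DecidableEq B] (p q s : ℝ) (l : L) (r : E → ℝ) (β : E → B) :
    Option L ⊕ E × Option B → ℝ
  | .inl none => p
  | .inl (some k) => if k = l then q else 0
  | .inr (e, none) => s * r e
  | .inr (e, some b) => if b = β e then s * r e else 0

/-- The state with registers `schemePos` and amplitudes `schemeCoeff`. -/
def schemeVec [DecidableEq I] [DecidableEq A] [AddCommGroup A] [DecidableEq L] [DecidableEq B]
    (idx : E → I) (x : I → A) (p q s : ℝ) (l : L) (r : E → ℝ) (β : E → B) :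
    QBasis I A (Option L ⊕ E × Option B) → ℂ :=
  sparseVec (schemePos idx x) fun w => (schemeCoeff p q s l r β w : ℂ)

variable [Fintype I] [DecidableEq I] [Fintype A] [DecidableEq A] [AddCommGroup A]
  [Fintype L] [DecidableEq L] [Fintype E] [Fintype B] [DecidableEq B]
  (idx : E → I) (x x' : I → A) (p q s p' q' s' : ℝ) (l l' : L) (r r' : E → ℝ) (β β' : E → B)

/-- Before the query the `none` branches of a node always overlap (answer register 0), while the
`some` branches, holding the negated entry, overlap only for equal entries. -/
theorem schemeVec_gram (hβ : ∀ e, x (idx e) = x' (idx e) → β e = β' e) :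
    star (schemeVec idx x p q s l r β) ⬝ᵥ schemeVec idx x' p' q' s' l' r' β' =
      ((p * p' + (if l = l' then q * q' else 0) +
        ∑ e, s * s' * (r e * r' e) * (1 + if x (idx e) = x' (idx e) then 1 else 0) : ℝ) : ℂ) := by
  rw [schemeVec, schemeVec, star_sparseVec_dotProduct]
  have h : ∀ w : Option L ⊕ E × Option B,
      (if schemePos idx x w = schemePos idx x' w then
        star (schemeCoeff p q s l r β w : ℂ) * (schemeCoeff p' q' s' l' r' β' w : ℂ) else 0) =
      ((if schemePos idx x w = schemePos idx x' w then
        schemeCoeff p q s l r β w * schemeCoeff p' q' s' l' r' β' w else 0 : ℝ) : ℂ) := by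
    intro w; split_ifs <;> simp
  rw [Finset.sum_congr rfl fun w _ => h w, ← Complex.ofReal_sum]
  congr 1
  rw [Fintype.sum_sum_type, Fintype.sum_option, Fintype.sum_prod_type]
  congr 1
  · simp [schemePos, schemeCoeff, eq_comm]
  · refine Finset.sum_congr rfl fun e _ => ?_
    rw [Fintype.sum_option]
    by_cases hx : x (idx e) = x' (idx e)
    · simp [schemePos, schemeCoeff, hx, hβ e hx]; ring
    · simp [schemePos, schemeCoeff, hx]; ring

/-- The query writes the entry in the `none` branch and erases it in the `some` branch. Compared
with `schemeVec_gram`, a node's overlap drops by its weight product exactly when the coarse answers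
differ. -/
theorem applyOracle_schemeVec_gram :
    star (applyOracle x (schemeVec idx x p q s l r β)) ⬝ᵥ
        applyOracle x' (schemeVec idx x' p' q' s' l' r' β') =
      ((p * p' + (if l = l' then q * q' else 0) +
        ∑ e, s * s' * (r e * r' e) *
          ((if x (idx e) = x' (idx e) then 1 else 0) + if β e = β' e then 1 else 0) : ℝ) : ℂ) := by
  rw [schemeVec, schemeVec, applyOracle_sparseVec, applyOracle_sparseVec,
    star_sparseVec_dotProduct]
  have h : ∀ w : Option L ⊕ E × Option B,
      (if queryMap x (schemePos idx x w) = queryMap x' (schemePos idx x' w) then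
        star (schemeCoeff p q s l r β w : ℂ) * (schemeCoeff p' q' s' l' r' β' w : ℂ) else 0) =
      ((if queryMap x (schemePos idx x w) = queryMap x' (schemePos idx x' w) then
        schemeCoeff p q s l r β w * schemeCoeff p' q' s' l' r' β' w else 0 : ℝ) : ℂ) := by
    intro w; split_ifs <;> simp
  rw [Finset.sum_congr rfl fun w _ => h w, ← Complex.ofReal_sum]
  congr 1
  rw [Fintype.sum_sum_type, Fintype.sum_option, Fintype.sum_prod_type]
  congr 1
  · simp [schemePos, schemeCoeff, queryMap, eq_comm]
  · refine Finset.sum_congr rfl fun e _ => ?_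
    rw [Fintype.sum_option]
    by_cases hx : x (idx e) = x' (idx e) <;> by_cases hβ : β e = β' e
    · simp [schemePos, schemeCoeff, queryMap, hx, hβ]; ring
    · simp [schemePos, schemeCoeff, queryMap, hx, hβ, Ne.symm hβ]; ring
    · simp [schemePos, schemeCoeff, queryMap, hx, hβ]; ring
    · simp [schemePos, schemeCoeff, queryMap, hx, hβ, Ne.symm hβ]

/-- The factor 2 counts the two branches of each node. -/
theorem sum_norm_schemeVec_sub_single_sq [DecidableEq E] :
    ∑ b, ‖((Pi.single (none, 0, .inl none) 1 : QBasis I A (Option L ⊕ E × Option B) → ℂ) -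
      schemeVec idx x 1 0 s l r β) b‖ ^ 2 = 2 * s ^ 2 * ∑ e, r e ^ 2 := by
  have h : (Pi.single (none, 0, .inl none) 1 : QBasis I A (Option L ⊕ E × Option B) → ℂ) -
      schemeVec idx x 1 0 s l r β =
      sparseVec (schemePos idx x) fun w => (schemeCoeff 0 0 (-s) l r β w : ℂ) := by
    funext ⟨i, a, w⟩
    simp only [schemeVec, sparseVec, Pi.sub_apply, Pi.single_apply, Prod.mk.injEq]
    rcases w with (_ | k) | ⟨e, _ | b⟩ <;> simp [schemePos, schemeCoeff, eq_comm]
    all_goals split_ifs <;> simp_all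
  rw [h, sum_norm_sparseVec_sq, Fintype.sum_sum_type, Fintype.sum_option, Fintype.sum_prod_type,
    Finset.mul_sum]
  simp only [Fintype.sum_option, schemeCoeff, Complex.norm_real, Real.norm_eq_abs, sq_abs]
  simp only [ite_pow, ne_eq, OfNat.ofNat_ne_zero, not_false_eq_true, zero_pow, ite_self,
    Finset.sum_const_zero, Finset.sum_ite_eq', Finset.mem_univ, if_true, zero_add]
  exact Finset.sum_congr rfl fun e _ => by ring

end schemeVec

namespace QueryAlgorithm

variable {I A α : Type} [Fintype I] [DecidableEq I] [Fintype A] [DecidableEq A] [AddCommGroup A]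

/-- If the unitaries of an algorithm move along the vectors `φ t`, then the distance of the state
from `φ t` stays constant. -/
theorem sum_norm_state_sub_sq (𝒜 : QueryAlgorithm I A α) (x : I → A) (T : ℕ)
    (φ : ℕ → QBasis I A 𝒜.W → ℂ)
    (h : ∀ t < T, (𝒜.U (t + 1)).1.mulVec (applyOracle x (φ t)) = φ (t + 1)) {t : ℕ} (ht : t ≤ T) :
    ∑ b, ‖(𝒜.state x t - φ t) b‖ ^ 2 = ∑ b, ‖(𝒜.state x 0 - φ 0) b‖ ^ 2 := by
  induction t with
  | zero => rfl
  | succ t ih =>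
    rw [← ih (by omega), state, ← h t (by omega), ← Matrix.mulVec_sub, ← applyOracle_sub,
      sum_norm_unitary_mulVec_sq, sum_norm_applyOracle_sq]

theorem le_prob (𝒜 : QueryAlgorithm I A α) (x : I → A) (b : QBasis I A 𝒜.W) :
    ‖𝒜.state x 𝒜.queries b‖ ^ 2 ≤ 𝒜.prob x (𝒜.out b) := by
  classical
  rw [prob]
  refine le_trans (by simp) (Finset.single_le_sum (f := fun b' => if 𝒜.out b' = 𝒜.out b then
    ‖𝒜.state x 𝒜.queries b'‖ ^ 2 else 0) (fun b' _ => ?_) (Finset.mem_univ b))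
  split_ifs <;> positivity

end QueryAlgorithm

/-- At distance 1/6 the amplitude is at least 5/6, and 25/36 exceeds 2/3. -/
theorem sq_le_norm_sq_of_sum_le {ι : Type} [Fintype ι] (u v : ι → ℂ) (b : ι) (hv : v b = 1)
    (h : ∑ b, ‖(u - v) b‖ ^ 2 ≤ 1 / 36) : 2 / 3 ≤ ‖u b‖ ^ 2 := by
  have h1 : ‖u b - 1‖ ^ 2 ≤ 1 / 36 := by
    refine le_trans ?_ h
    rw [← hv]
    exact Finset.single_le_sum (f := fun b => ‖(u - v) b‖ ^ 2) (fun _ _ => by positivity)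
      (Finset.mem_univ b)
  have h2 : ‖u b - 1‖ ≤ 1 / 6 := by nlinarith [norm_nonneg (u b - 1)]
  have h3 : (1 : ℝ) ≤ ‖u b‖ + ‖u b - 1‖ := by
    have := norm_sub_le (u b) (u b - 1)
    simpa using this
  nlinarith

/-- Vectors `φ t x` whose Gram matrices are compatible with the queries are followed by a quantum
query algorithm: it succeeds if its initial state is close to all the `φ 0 x`. -/
theorem exists_queryAlgorithm_of_gram {I A X α W : Type} [Fintype I] [DecidableEq I] [Fintype A]
    [DecidableEq A] [AddCommGroup A] [Fintype W] [DecidableEq W] (inp : X → I → A) (f : X → α)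
    (T : ℕ) (φ : ℕ → X → QBasis I A W → ℂ)
    (hφ : ∀ t < T, ∀ x y, star (applyOracle (inp x) (φ t x)) ⬝ᵥ applyOracle (inp y) (φ t y) =
      star (φ (t + 1) x) ⬝ᵥ φ (t + 1) y)
    (init : QBasis I A W)
    (h0 : ∀ x, ∑ b, ‖((Pi.single init 1 : QBasis I A W → ℂ) - φ 0 x) b‖ ^ 2 ≤ 1 / 36)
    (out : QBasis I A W → α) (hout : ∀ x, ∃ b, φ T x b = 1 ∧ out b = f x) :
    ∃ 𝒜 : QueryAlgorithm I A α, 𝒜.queries = T ∧ ∀ x, 2 / 3 ≤ 𝒜.prob (inp x) (f x) := by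
  have hU : ∀ t, ∃ U : Matrix.unitaryGroup (QBasis I A W) ℂ, t < T →
      ∀ x, U.1.mulVec (applyOracle (inp x) (φ t x)) = φ (t + 1) x := by
    intro t
    by_cases ht : t < T
    · obtain ⟨U, hU⟩ := exists_unitary_of_gram_eq _ _ (hφ t ht)
      exact ⟨U, fun _ => hU⟩
    · exact ⟨1, fun h => absurd h ht⟩
  choose U hU using hU
  let 𝒜 : QueryAlgorithm I A α :=
    { W := W
      queries := T
      -- The unitary before the first query is the identity, so the state there is `init` itself.
      U := fun t => Nat.casesOn t 1 U
      init := init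
      out := out }
  refine ⟨𝒜, rfl, fun x => ?_⟩
  have h1 := 𝒜.sum_norm_state_sub_sq (inp x) T (fun t => φ t x) (fun t ht => hU t ht x) le_rfl
  have h2 : 𝒜.state (inp x) 0 = Pi.single init 1 := by
    change ((1 : Matrix.unitaryGroup (QBasis I A W) ℂ).1).mulVec (Pi.single init 1) = _
    exact Matrix.one_mulVec _
  obtain ⟨b, hb, hbf⟩ := hout x
  refine (sq_le_norm_sq_of_sum_le _ _ b hb (h1.trans_le ?_)).trans ((𝒜.le_prob _ b).trans_eq ?_)
  · rw [h2]; exact h0 x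
  · exact congrArg _ hbf

/-- A query scheme of cost `K` gives a quantum query algorithm with `O(K)` queries. -/
theorem HasQueryScheme.exists_queryAlgorithm {I A X α B : Type} [Fintype I] [DecidableEq I]
    [Fintype A] [DecidableEq A] [AddCommGroup A] [Fintype B] [DecidableEq B] [Finite X] [Inhabited α]
    {inp : X → I → A}
    {out : X → α} {K : ℝ} (hK : 0 ≤ K) (h : HasQueryScheme B inp Set.univ out K) :
    ∃ 𝒜 : QueryAlgorithm I A α, 𝒜.queries = ⌈72 * K⌉₊ ∧
      ∀ x, 2 / 3 ≤ 𝒜.prob (inp x) (out x) := by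
  classical
  obtain ⟨E, _, idx, g, r, τ, h1, h2, h3⟩ := h
  simp only [Set.mem_univ, forall_true_left] at h1 h2 h3
  -- The final register holds the transcript rather than the output, since the scheme's identity
  -- distinguishes transcripts.
  let L := Set.range τ
  have : Fintype L := Fintype.ofFinite L
  let l : X → L := fun x => ⟨τ x, x, rfl⟩
  let h : L → α := fun k => out k.2.choose
  have hh : ∀ x, h (l x) = out x := fun x => h1 _ _ (l x).2.choose_spec
  have hl : ∀ x y, l x = l y ↔ τ x = τ y := fun x y => Subtype.ext_iff
  let T := ⌈72 * K⌉₊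
  have hT : 72 * K ≤ T := Nat.le_ceil _
  -- Without queries the cost is 0, all weights vanish, and the scheme's identity forces equal
  -- transcripts; the output is constant.
  rcases Nat.eq_zero_or_pos T with hT0 | hTpos
  · have hK0 : K = 0 := by
      rw [hT0] at hT; push_cast at hT; linarith
    have hr : ∀ x e, r e x = 0 := fun x e => by
      have h4 : ∑ e, r e x ^ 2 = 0 := le_antisymm (hK0 ▸ h3 x) (by positivity)
      rw [Finset.sum_eq_zero_iff_of_nonneg fun _ _ => by positivity] at h4
      exact pow_eq_zero_iff two_ne_zero |>.1 (h4 e (Finset.mem_univ e))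
    have hτ : ∀ x y, out x = out y := fun x y => h1 x y (by
      by_contra hne
      have := h2 x y
      simp [hr, hne] at this)
    refine ⟨⟨Unit, 0, fun _ => 1, (none, 0, ()), fun _ =>
      if hX : Nonempty X then out hX.some else default⟩, hT0.symm, fun x => ?_⟩
    refine le_trans ?_ ((QueryAlgorithm.le_prob _ _ (none, 0, ())).trans_eq (congrArg _ ?_))
    · simp [QueryAlgorithm.state]; norm_num
    · simp only [show Nonempty X from ⟨x⟩, dite_true]
      exact hτ _ _
  · have hTR : (0 : ℝ) < T := by exact_mod_cast hTpos
    -- Each step moves squared amplitude `1 / T` from the start symbol to the transcript. This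
    -- lowers the Gram entry by `1 / T` exactly for different transcripts, which is what the query
    -- does to the node part.
    let φ : ℕ → X → QBasis I A (Option L ⊕ E × Option B) → ℂ := fun t x =>
      schemeVec idx (inp x) (√(1 - t / T)) (√(t / T)) (√(1 / T)) (l x) (fun e => r e x)
        fun e => g e (inp x (idx e))
    refine exists_queryAlgorithm_of_gram inp out T φ (fun t ht x y => ?_) (none, 0, .inl none)
      (fun x => ?_) (fun b => match b.2.2 with
        | .inl (some k) => h k
        | _ => default) fun x => ⟨(none, 0, .inl (some (l x))), ?_, hh x⟩
    · have ht1 : (0 : ℝ) ≤ 1 - t / T := by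
        rw [sub_nonneg, div_le_one hTR]; exact_mod_cast ht.le
      have ht2 : (0 : ℝ) ≤ 1 - (t + 1 : ℕ) / T := by
        rw [sub_nonneg, div_le_one hTR]; exact_mod_cast ht
      simp only [φ]
      rw [applyOracle_schemeVec_gram, schemeVec_gram _ _ _ _ _ _ _ _ _ _ _ _ _ _ _
        (fun e he => by rw [he])]
      congr 1
      rw [Real.mul_self_sqrt ht1, Real.mul_self_sqrt ht2, Real.mul_self_sqrt (by positivity),
        Real.mul_self_sqrt (by positivity), Real.mul_self_sqrt (by positivity)]
      have h4 : ∑ e, 1 / (T : ℝ) * (r e x * r e y) *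
          (1 + if inp x (idx e) = inp y (idx e) then 1 else 0) =
        ∑ e, 1 / (T : ℝ) * (r e x * r e y) *
          ((if inp x (idx e) = inp y (idx e) then 1 else 0) +
            if g e (inp x (idx e)) = g e (inp y (idx e)) then 1 else 0) +
        1 / T * if τ x = τ y then 0 else 1 := by
        rw [← h2 x y, Finset.mul_sum, ← Finset.sum_add_distrib]
        refine Finset.sum_congr rfl fun e _ => ?_
        split_ifs <;> ring
      simp only [hl]
      rw [h4]
      push_cast
      split_ifs <;> ring
    · have h5 : φ 0 x = schemeVec idx (inp x) 1 0 (√(1 / T)) (l x) (fun e => r e x)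
        fun e => g e (inp x (idx e)) := by simp [φ]
      rw [h5]
      refine (sum_norm_schemeVec_sub_single_sq idx (inp x) _ _ _ _).trans_le ?_
      rw [Real.sq_sqrt (by positivity), mul_one_div, div_mul_eq_mul_div, div_le_iff₀ hTR]
      linarith [h3 x]
    · simp [φ, schemeVec, sparseVec, schemePos, schemeCoeff, hTR.ne']

/-! ### The adjacency matrix model -/

section matrixModel

variable {n : ℕ}

theorem weight_mul_weight {B : Type} [DecidableEq B] {a : ℝ} (ha : 0 < a) (b₀ : B) {b b' : B}
    (hbb : b ≠ b') (h : b = b₀ ∨ b' = b₀) :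
    (if b = b₀ then √a else (√a)⁻¹) * (if b' = b₀ then √a else (√a)⁻¹) = 1 := by
  have := (Real.sqrt_pos.2 ha).ne'
  rcases h with rfl | rfl
  · simp [hbb.symm, this]
  · simp [hbb, this]

theorem weight_sq {B : Type} [DecidableEq B] {a : ℝ} (ha : 0 < a) (b₀ b : B) :
    (if b = b₀ then √a else (√a)⁻¹) ^ 2 = if b = b₀ then a else a⁻¹ := by
  split_ifs
  · exact Real.sq_sqrt ha.le
  · rw [inv_pow, Real.sq_sqrt ha.le]

open Classical in
/-- The search for the neighbours of `v` in `F`: the vertices of `R` are still to be examined, and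
`N` is the set of the neighbours found among the others. -/
theorem hasQueryScheme_matrix_search {α : Type} {a k : ℝ} (ha : 0 < a) (hk : a⁻¹ ≤ k)
    (out : SimpleGraph (Fin n) → α) (v : Fin n) (F : Finset (Fin n))
    (hF : ∀ N ⊆ F, HasQueryScheme (Fin 2) adjMatrixInput {G | F.filter (G.Adj v) = N} out
      ((F.card - N.card) * k))
    (R : Finset (Fin n)) : R ⊆ F → ∀ N ⊆ F \ R,
      HasQueryScheme (Fin 2) adjMatrixInput {G | (F \ R).filter (G.Adj v) = N} out
        (R.card * a + (F.card - N.card) * k) := by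
  induction R using Finset.induction_on with
  | empty =>
    intro _ N hN
    simpa using hF N (by simpa using hN)
  | insert w R hw ih =>
    intro hR N hN
    have hwF : w ∈ F := hR (Finset.mem_insert_self _ _)
    have hRF : R ⊆ F := (Finset.subset_insert _ _).trans hR
    have hsd : F \ R = insert w (F \ insert w R) := by
      ext u; simp only [Finset.mem_sdiff, Finset.mem_insert]
      by_cases h : u = w
      · subst h; simp [hwF, hw]
      · simp [h]
    have hwN : w ∉ N := fun h => by simpa using hN h
    refine HasQueryScheme.node (v, w) id (fun b => if b = 0 then √a else (√a)⁻¹) ?_ fun b => ?_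
    · intro z z' hz
      refine weight_mul_weight ha _ hz ?_
      have : ∀ z z' : Fin 2, z ≠ z' → z = 0 ∨ z' = 0 := by decide
      exact this _ _ hz
    · rw [weight_sq ha]
      by_cases hb : b = 0
      · subst hb
        refine (ih hRF N (hsd ▸ hN.trans (Finset.subset_insert _ _))).mono ?_ ?_
          (fun _ _ _ _ h => h)
        · rintro G ⟨hG, hGw⟩
          have hadj : ¬ G.Adj v w := fun h => by simp [adjMatrixInput, h] at hGw
          simp only [Set.mem_ofPred_eq] at hG ⊢
          rw [hsd, Finset.filter_insert, if_neg hadj, hG]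
        · rw [if_pos rfl, Finset.card_insert_of_notMem hw]; push_cast; linarith
      · refine (ih hRF (insert w N) (hsd ▸ Finset.insert_subset_insert _ hN)).mono ?_ ?_
          (fun _ _ _ _ h => h)
        · rintro G ⟨hG, hGw⟩
          have hadj : G.Adj v w := by
            by_contra h
            exact hb (hGw ▸ by simp [adjMatrixInput, h])
          simp only [Set.mem_ofPred_eq] at hG ⊢
          rw [hsd, Finset.filter_insert, if_pos hadj, hG]
        -- The price `a⁻¹` of an edge is covered by the budget `k` released by the new element of
        -- `N`.
        · rw [if_neg hb, Finset.card_insert_of_notMem hw, Finset.card_insert_of_notMem hwN]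
          push_cast; linarith

theorem hasQueryScheme_matrix_greedyLoop (c : ChoiceRule (Fin n)) {a : ℝ} (ha : 0 < a)
    (S F : Finset (Fin n)) :
    HasQueryScheme (Fin 2) adjMatrixInput Set.univ (fun G => greedyLoop G c S F)
      (F.card * (a * n + a⁻¹)) := by
  classical
  induction hk : F.card using Nat.strong_induction_on generalizing S F with
  | _ k ih =>
    subst hk
    rcases F.eq_empty_or_nonempty with rfl | h
    · exact HasQueryScheme.of_const (fun G _ G' _ => by rw [greedyLoop_empty, greedyLoop_empty])
        (by simp)
    · set v := c.pick S F h with hv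
      have hvF : v ∈ F := c.pick_mem S F h
      have hfil : ∀ G : SimpleGraph (Fin n), (F.erase v).filter (G.Adj v) = F.filter (G.Adj v) :=
        fun G => by
          rw [Finset.filter_erase, Finset.erase_eq_of_notMem]; simp
      have hcard : ((F.erase v).card : ℝ) = F.card - 1 := by
        rw [Finset.card_erase_of_mem hvF, Nat.cast_sub (Finset.card_pos.2 h), Nat.cast_one]
      have hn : (F.card : ℝ) ≤ n := by
        exact_mod_cast (Finset.card_le_univ F).trans_eq (Fintype.card_fin n)
      -- A vertex's budget covers either `a⁻¹`, when it is deleted as a neighbour, or the at most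
      -- `n` unsurprising answers of its own search, when it is chosen.
      have key := hasQueryScheme_matrix_search (k := a * n + a⁻¹) ha
        (by have : (0 : ℝ) ≤ a * n := by positivity
            linarith) (fun G => greedyLoop G c S F) v (F.erase v)
        (fun N hN => ?_) (F.erase v) subset_rfl ∅ (by simp)
      · refine key.mono (fun G _ => by simp) ?_ (fun _ _ _ _ h => h)
        rw [hcard, Finset.card_empty]
        have : (0 : ℝ) ≤ a⁻¹ := by positivity
        have : (F.card : ℝ) * a ≤ n * a := by gcongr
        push_cast
        nlinarith
      · have hlt : (F \ insert v N).card < F.card := Finset.card_lt_card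
          ((Finset.ssubset_iff_of_subset Finset.sdiff_subset).2 ⟨v, hvF, by simp⟩)
        refine (ih _ hlt (insert v S) (F \ insert v N) rfl).mono (Set.subset_univ _) ?_ ?_
        · have hc : (F \ insert v N) = F.erase v \ N := by ext u; simp; tauto
          rw [hc, Finset.card_sdiff_of_subset hN, Nat.cast_sub (Finset.card_le_card hN)]
        · intro G hG G' hG' hout
          simp only [Set.mem_ofPred_eq, hfil] at hG hG'
          rw [greedyLoop_of_nonempty G c S F h N (by simp [← hG, hv]),
            greedyLoop_of_nonempty G' c S F h N (by simp [← hG', hv]), ← hv, hout]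

end matrixModel

/-! ### The adjacency list model -/

section listModel

variable {n : ℕ} {d : Fin n → ℕ}

/-- Graphs with prescribed degrees together with an adjacency list. -/
abbrev ListInput (d : Fin n → ℕ) : Type :=
  {x : SimpleGraph (Fin n) × ((Σ i : Fin n, Fin (d i)) → Fin n) // IsAdjList x.1 d x.2}

/-- The adjacency list, as an input string. -/
def ListInput.arrays (x : ListInput d) : (Σ i : Fin n, Fin (d i)) → Fin n := x.1.2

theorem ListInput.adj_iff (x : ListInput d) (v w : Fin n) :
    x.1.1.Adj v w ↔ ∃ j, x.arrays ⟨v, j⟩ = w := by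
  have := (x.2 v).2
  rw [← SimpleGraph.mem_neighborSet, ← this]; rfl

/-- The cost that is reserved for the vertex `u`. -/
noncomputable def vertexCost (d : Fin n → ℕ) (a : ℝ) (u : Fin n) : ℝ :=
  d u * a + if d u = 0 then 0 else a⁻¹ + 1

/-- This pays for reading the array of `u` when `u` is chosen. -/
theorem vertexCost_ge {a : ℝ} (ha : 0 < a) (u : Fin n) : d u * a ≤ vertexCost d a u := by
  rw [vertexCost]
  split_ifs
  · simp
  · have : 0 < a⁻¹ := by positivity
    linarith

/-- This pays for finding `u` as a neighbour: `a⁻¹` for the surprise and 1 for its name. Isolated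
vertices are never found and must be free, since an edgeless graph allows no queries. -/
theorem vertexCost_ge_of_ne_zero {a : ℝ} (ha : 0 < a) {u : Fin n} (hu : d u ≠ 0) :
    a⁻¹ + 1 ≤ vertexCost d a u := by
  rw [vertexCost, if_neg hu]
  have : 0 ≤ d u * a := by positivity
  linarith

/-- The search for the neighbours of `v` in `F`: the last `k` entries of the array of `v` are still
to be queried, and `N` is the set of the neighbours in `F` found in the others. -/
theorem hasQueryScheme_list_search {α : Type} {a : ℝ} (ha : 0 < a)
    (out : ListInput d → α) (v : Fin n) (F : Finset (Fin n))
    (hF : ∀ N : Finset (Fin n), HasQueryScheme (Option (Fin n)) ListInput.arrays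
      {x : ListInput d | ∀ w, w ∈ N ↔ w ∈ F ∧ x.1.1.Adj v w} out
      (∑ u ∈ F \ insert v N, vertexCost d a u))
    (k : ℕ) : k ≤ d v → ∀ N : Finset (Fin n),
      HasQueryScheme (Option (Fin n)) ListInput.arrays
        {x : ListInput d | ∀ w, w ∈ N ↔
          w ∈ F ∧ ∃ j : Fin (d v), j.1 + k < d v ∧ x.arrays ⟨v, j⟩ = w} out
        (k * a + ∑ u ∈ F \ insert v N, vertexCost d a u) := by
  induction k with
  | zero =>
    intro _ N
    refine (hF N).mono (fun x hx => ?_) (by simp) (fun _ _ _ _ h => h)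
    simp only [Set.mem_ofPred_eq, add_zero] at hx ⊢
    intro w
    rw [hx, x.adj_iff]
    simp
  | succ k ih =>
    intro hk N
    let j₀ : Fin (d v) := ⟨d v - (k + 1), by omega⟩
    have hj : ∀ j : Fin (d v), j.1 + k < d v ↔ j.1 + (k + 1) < d v ∨ j = j₀ := fun j => by
      rw [Fin.ext_iff]; simp only [j₀]; omega
    -- Only membership in `F` is asked here; `some v` is a mere flag.
    refine HasQueryScheme.node ⟨v, j₀⟩ (fun z => if z ∈ F then some v else none)
      (fun b => if b = none then √a else (√a)⁻¹) ?_ fun b => ?_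
    · intro z z' hz
      refine weight_mul_weight ha _ hz ?_
      by_cases h : z ∈ F <;> by_cases h' : z' ∈ F <;> simp_all
    rw [weight_sq ha]
    rcases b with _ | b
    · refine (ih (by omega) N).mono ?_ ?_ (fun _ _ _ _ h => h)
      · rintro x ⟨hx, hxj⟩ w
        have hxF : x.arrays ⟨v, j₀⟩ ∉ F := by simpa using hxj
        rw [hx w]
        refine and_congr_right fun hw => exists_congr fun j => ?_
        rw [hj, or_and_right]
        refine ⟨Or.inl, fun h => h.elim id ?_⟩
        rintro ⟨rfl, rfl⟩
        exact absurd hw hxF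
      · rw [if_pos rfl]; push_cast; linarith
    · rw [if_neg (by simp)]
      -- The same entry is asked again for its name. Any two names need weight product 1, hence unit
      -- weights.
      refine HasQueryScheme.node ⟨v, j₀⟩ some (fun _ => 1) (by simp) fun b' => ?_
      by_cases hne : ∃ x : ListInput d, (∀ w, w ∈ N ↔
          w ∈ F ∧ ∃ j : Fin (d v), j.1 + (k + 1) < d v ∧ x.arrays ⟨v, j⟩ = w) ∧
          x.arrays ⟨v, j₀⟩ ∈ F ∧ some (x.arrays ⟨v, j₀⟩) = b'
      · obtain ⟨x₀, hx₀, hw₀F, rfl⟩ := hne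
        set w₀ := x₀.arrays ⟨v, j₀⟩ with hw₀
        have hadj : x₀.1.1.Adj v w₀ := (x₀.adj_iff v w₀).2 ⟨j₀, rfl⟩
        have hw₀N : w₀ ∉ N := by
          rw [hx₀]
          rintro ⟨-, j, hjk, hj'⟩
          have : j = j₀ := (x₀.2 v).1 hj'
          subst this
          simp only [j₀] at hjk
          omega
        have hd : d w₀ ≠ 0 := by
          obtain ⟨j, -⟩ := (x₀.adj_iff w₀ v).1 hadj.symm
          exact fun h => (h ▸ j).elim0
        refine (ih (by omega) (insert w₀ N)).mono ?_ ?_ (fun _ _ _ _ h => h)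
        · rintro x ⟨⟨hx, -⟩, hxj⟩ w
          have hxw : x.arrays ⟨v, j₀⟩ = w₀ := by simpa using hxj
          simp only [Finset.mem_insert, hx w, hj]
          constructor
          · rintro (rfl | ⟨hw, j, h1, h2⟩)
            · exact ⟨hw₀F, j₀, Or.inr rfl, hxw⟩
            · exact ⟨hw, j, Or.inl h1, h2⟩
          · rintro ⟨hw, j, h1 | rfl, h2⟩
            · exact Or.inr ⟨hw, j, h1, h2⟩
            · exact Or.inl (h2.symm.trans hxw)
        -- The vertex `w₀` is new because an array has no repetitions, so its reserved cost is still
        -- available.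
        · have hmem : w₀ ∈ F \ insert v N := by
            simp [hw₀F, hw₀N, hadj.ne']
          have hsd : F \ insert v (insert w₀ N) = (F \ insert v N).erase w₀ := by
            ext u; simp only [Finset.mem_sdiff, Finset.mem_insert, Finset.mem_erase]; tauto
          have h1 := Finset.add_sum_erase (F \ insert v N) (vertexCost d a) hmem
          rw [hsd]
          have h2 := vertexCost_ge_of_ne_zero (d := d) ha hd
          push_cast
          linarith
      · refine HasQueryScheme.of_empty ?_
        rintro x ⟨⟨hx, hxv⟩, hxb⟩
        refine hne ⟨x, hx, ?_, hxb⟩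
        by_contra h
        simp [h] at hxv

theorem hasQueryScheme_list_greedyLoop (c : ChoiceRule (Fin n)) {a : ℝ} (ha : 0 < a)
    (S F : Finset (Fin n)) :
    HasQueryScheme (Option (Fin n)) (ListInput.arrays (d := d)) Set.univ
      (fun x => greedyLoop x.1.1 c S F) (∑ u ∈ F, vertexCost d a u) := by
  classical
  induction hk : F.card using Nat.strong_induction_on generalizing S F with
  | _ k ih =>
    subst hk
    rcases F.eq_empty_or_nonempty with rfl | h
    · exact HasQueryScheme.of_const (fun G _ G' _ => by rw [greedyLoop_empty, greedyLoop_empty])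
        (by simp)
    · set v := c.pick S F h with hv
      have hvF : v ∈ F := c.pick_mem S F h
      have key := hasQueryScheme_list_search (d := d) ha
        (fun x => greedyLoop x.1.1 c S F) v F (fun N => ?_) (d v) le_rfl ∅
      · refine key.mono (fun x _ => by simp) ?_ (fun _ _ _ _ h => h)
        rw [insert_empty_eq, Finset.sdiff_singleton_eq_erase, ← Finset.add_sum_erase F _ hvF]
        have := vertexCost_ge (d := d) ha v
        linarith
      · have hlt : (F \ insert v N).card < F.card := Finset.card_lt_card
          ((Finset.ssubset_iff_of_subset Finset.sdiff_subset).2 ⟨v, hvF, by simp⟩)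
        refine (ih _ hlt (insert v S) (F \ insert v N) rfl).mono (Set.subset_univ _) le_rfl ?_
        intro x hx y hy hout
        rw [greedyLoop_of_nonempty _ c S F h N hx, greedyLoop_of_nonempty _ c S F h N hy, ← hv,
          hout]

/-- The degrees determine `m`, so one number of queries serves all graphs with these degrees. -/
theorem IsAdjList.sum_eq {G : SimpleGraph (Fin n)} {f : (Σ i : Fin n, Fin (d i)) → Fin n}
    (h : IsAdjList G d f) : ∑ i, d i = 2 * G.edgeSet.ncard := by
  classical
  rw [← SimpleGraph.coe_edgeFinset, Set.ncard_coe_finset,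
    ← G.sum_degrees_eq_twice_card_edges]
  refine Finset.sum_congr rfl fun i _ => ?_
  rw [← SimpleGraph.card_neighborSet_eq_degree, ← Nat.card_eq_fintype_card, ← (h i).2,
    Nat.card_range_of_injective (h i).1, Nat.card_fin]

/-- With the best choice of the weights, the total cost is `O(√(n M))`, where `M` is the sum of the
degrees. -/
theorem exists_sum_vertexCost_le (d : Fin n → ℕ) (hn : 0 < n) :
    ∃ a : ℝ, 0 < a ∧ ∑ u, vertexCost d a u ≤ 3 * √((n : ℝ) * (∑ u, d u : ℕ)) := by
  rcases Nat.eq_zero_or_pos (∑ u, d u) with hM | hM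
  · refine ⟨1, one_pos, ?_⟩
    rw [Finset.sum_eq_zero]
    · positivity
    · intro u hu
      have := (Finset.sum_eq_zero_iff.1 hM) u hu
      simp [vertexCost, this]
  · set M := ∑ u, d u with hMdef
    have hn' : (0 : ℝ) < n := by exact_mod_cast hn
    have hM' : (0 : ℝ) < M := by exact_mod_cast hM
    set k := (Finset.univ.filter fun u => d u ≠ 0).card with hk
    have hkn : (k : ℝ) ≤ n := by
      exact_mod_cast (Finset.card_le_univ _).trans_eq (Fintype.card_fin n)
    have hkM : (k : ℝ) ≤ M := by
      have : k ≤ M := by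
        rw [hk, Finset.card_filter]
        exact Finset.sum_le_sum fun u _ => by split_ifs <;> omega
      exact_mod_cast this
    have hsum : ∀ a : ℝ, ∑ u, vertexCost d a u = M * a + k * (a⁻¹ + 1) := fun a => by
      simp only [vertexCost, Finset.sum_add_distrib, ← Finset.sum_mul, hMdef]
      push_cast
      congr 1
      simp only [← ite_not (d _ = 0)]
      rw [← Finset.sum_filter, Finset.sum_const, nsmul_eq_mul]
    have hsn := Real.sqrt_pos.2 hn'
    have hsM := Real.sqrt_pos.2 hM'
    -- This choice balances `M * a` against `n * a⁻¹`; the remaining `k` is at most both `n` and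
    -- `M`.
    refine ⟨√n / √M, by positivity, ?_⟩
    rw [hsum, Real.sqrt_mul hn'.le, inv_div]
    have e1 : (M : ℝ) * (√n / √M) = √n * √M := by
      field_simp
      rw [Real.sq_sqrt hM'.le]
    have e2 : (k : ℝ) * (√M / √n) ≤ √n * √M := by
      calc (k : ℝ) * (√M / √n) ≤ n * (√M / √n) := by gcongr
        _ = √n * √M := by
          field_simp
          rw [Real.sq_sqrt hn'.le]
    have e3 : (k : ℝ) ≤ √n * √M := by
      rw [← Real.sqrt_mul hn'.le]
      refine Real.le_sqrt_of_sq_le ?_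
      rw [sq]
      gcongr
    linarith

end listModel

/-! ### The query complexity of the greedy algorithm -/

theorem exists_queryAlgorithm_adjMatrix (n : ℕ) [NeZero n] (c : ChoiceRule (Fin n)) :
    ∃ 𝒜 : QueryAlgorithm (Fin n × Fin n) (Fin 2) (List (Fin n × Finset (Fin n))),
      (𝒜.queries : ℝ) ≤ 145 * (n : ℝ) ^ (3 / 2 : ℝ) ∧
      ∀ G : SimpleGraph (Fin n), 2 / 3 ≤ 𝒜.prob (adjMatrixInput G) (greedyRun G c) := by
  have hn : (1 : ℝ) ≤ n := by exact_mod_cast NeZero.one_le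
  have hs : 0 < √(n : ℝ) := Real.sqrt_pos.2 (by linarith)
  have hpow : (n : ℝ) ^ (3 / 2 : ℝ) = n * √n := by
    rw [Real.sqrt_eq_rpow, ← Real.rpow_one_add' (by linarith) (by norm_num)]
    norm_num
  -- The value `a = (√n)⁻¹` balances `a * n` against `a⁻¹`.
  have h := hasQueryScheme_matrix_greedyLoop c (inv_pos.2 hs) ∅ Finset.univ
  have hK : ((Finset.univ : Finset (Fin n)).card : ℝ) * ((√n)⁻¹ * n + (√n)⁻¹⁻¹) =
      2 * (n * √n) := by
    have : (√(n : ℝ))⁻¹ * n = √n := by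
      rw [inv_mul_eq_div, Real.div_sqrt]
    rw [this, inv_inv, Finset.card_univ, Fintype.card_fin]
    ring
  rw [hK] at h
  obtain ⟨𝒜, hq, hp⟩ := h.exists_queryAlgorithm (by positivity)
  refine ⟨𝒜, ?_, hp⟩
  rw [hq, hpow]
  have h1 := Nat.ceil_lt_add_one (show 0 ≤ 72 * (2 * ((n : ℝ) * √n)) by positivity)
  have h2 : (1 : ℝ) ≤ n * √n := by
    have : 1 ≤ √(n : ℝ) := Real.one_le_sqrt.2 hn
    nlinarith
  linarith

theorem exists_queryAlgorithm_adjList (n : ℕ) [NeZero n] (d : Fin n → ℕ)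
    (c : ChoiceRule (Fin n)) :
    ∃ 𝒜 : QueryAlgorithm (Σ i : Fin n, Fin (d i)) (Fin n) (List (Fin n × Finset (Fin n))),
      ∀ (G : SimpleGraph (Fin n)) (f : (Σ i : Fin n, Fin (d i)) → Fin n), IsAdjList G d f →
        (𝒜.queries : ℝ) ≤ 438 * √((n : ℝ) * (G.edgeSet.ncard : ℝ)) ∧
        2 / 3 ≤ 𝒜.prob f (greedyRun G c) := by
  obtain ⟨a, ha, hK⟩ := exists_sum_vertexCost_le d (NeZero.pos n)
  have h := (hasQueryScheme_list_greedyLoop (d := d) c ha ∅ Finset.univ).mono subset_rfl hK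
    (fun _ _ _ _ h => h)
  obtain ⟨𝒜, hq, hp⟩ := h.exists_queryAlgorithm (by positivity)
  refine ⟨𝒜, fun G f hf => ⟨?_, hp ⟨(G, f), hf⟩⟩⟩
  rw [hq, hf.sum_eq]
  -- Without edges the count is exactly 0; otherwise `1 ≤ s` absorbs the rounding up.
  rcases Nat.eq_zero_or_pos G.edgeSet.ncard with hm | hm
  · simp [hm]
  · have hn : (1 : ℝ) ≤ n := by exact_mod_cast NeZero.one_le
    have hm' : (1 : ℝ) ≤ G.edgeSet.ncard := by exact_mod_cast hm
    set s := √((n : ℝ) * (G.edgeSet.ncard : ℝ)) with hs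
    have h1 : 1 ≤ s := Real.one_le_sqrt.2 (by nlinarith)
    have h2 : √((n : ℝ) * (2 * G.edgeSet.ncard : ℕ)) ≤ 2 * s := by
      rw [Real.sqrt_le_left (by positivity), mul_pow, hs, Real.sq_sqrt (by positivity)]
      push_cast
      nlinarith
    have h3 := Nat.ceil_lt_add_one
      (show 0 ≤ 72 * (3 * √((n : ℝ) * (2 * G.edgeSet.ncard : ℕ))) by positivity)
    linarith

theorem mainTheorem1 :
    (∀ (n : ℕ) (c : ChoiceRule (Fin n)) (G : SimpleGraph (Fin n)),
      Maximal (fun S : Set (Fin n) => G.IsIndepSet S) (chosenVertices (greedyRun G c))) ∧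
    (∃ C : ℝ, ∀ (n : ℕ) [NeZero n] (c : ChoiceRule (Fin n)),
      ∃ 𝒜 : QueryAlgorithm (Fin n × Fin n) (Fin 2) (List (Fin n × Finset (Fin n))),
        (𝒜.queries : ℝ) ≤ C * (n : ℝ) ^ (3 / 2 : ℝ) ∧
        ∀ G : SimpleGraph (Fin n), 2 / 3 ≤ 𝒜.prob (adjMatrixInput G) (greedyRun G c)) ∧
    (∃ C : ℝ, ∀ (n : ℕ) [NeZero n] (d : Fin n → ℕ) (c : ChoiceRule (Fin n)),
      ∃ 𝒜 : QueryAlgorithm (Σ i : Fin n, Fin (d i)) (Fin n) (List (Fin n × Finset (Fin n))),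
        ∀ (G : SimpleGraph (Fin n)) (f : (Σ i : Fin n, Fin (d i)) → Fin n), IsAdjList G d f →
          (𝒜.queries : ℝ) ≤ C * √((n : ℝ) * (G.edgeSet.ncard : ℝ)) ∧
          2 / 3 ≤ 𝒜.prob f (greedyRun G c)) := by
  refine ⟨fun n c G => maximal_chosenVertices_greedyRun G c,
    ⟨145, fun n _ c => exists_queryAlgorithm_adjMatrix n c⟩,
    ⟨438, fun n _ d c => exists_queryAlgorithm_adjList n d c⟩⟩
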